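/- **Model.** Let $M,K\ge 2$, $q\ge 0$, $p_1,\dots,p_M\ge 1$, $p=\prod_m p_m$. Let $(Y^i,\mathbf U^i,\mathbf X^i)$, $i=1,\dots,n$, be i.i.d. from the CATCH model: $\Pr(Y=k)=\pi_k>0$ for $k=1,\dots,K$; $\mathbf U\mid(Y=k)\sim N(\boldsymbol\phi_k,\boldsymbol\Psi)$ in $\mathbb R^q$ with $\boldsymbol\Psi>0$; and $\mathbf X\mid(\mathbf U=\mathbf u,Y=k)\sim TN(\boldsymbol\mu_k+\boldsymbol\alpha\bar\times_{(M+1)}\mathbf u,\boldsymbol\Sigma_1,\dots,\boldsymbol\Sigma_M)$ in $\mathbb R^{p_1\times\cdots\times p_M}$ with all $\boldsymbol\Sigma_m>0$. Here $(\boldsymbol\alpha\bar\times_{(M+1)}\mathbf u)_{j_1\cdots j_M}=\sum_l\alpha_{j_1\cdots j_M l}u_l$, and $TN(\boldsymbol\mu,\boldsymbol\Sigma_1,\dots,\boldsymbol\Sigma_M)$ is the law of $\boldsymbol\mu+[\![\mathbf Z;\boldsymbol\Sigma_1^{1/2},\dots,\boldsymbol\Sigma_M^{1/2}]\!]$, where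 $\mathbf Z$ has i.i.d. $N(0,1)$ entries and $[\![\mathbf C;\mathbf G_1,\dots,\mathbf G_M]\!]=\mathbf C\times_1\mathbf G_1\cdots\times_M\mathbf G_M$. **Estimators.** Let $\overline{\mathbf X}_k,\overline{\mathbf U}_k$ be the sample means within class $k$ (zero if the class is not observed), $\widetilde{\mathbf X}^i=\mathbf X^i-\overline{\mathbf X}_{Y^i}$, $\widetilde{\mathbf U}^i=\mathbf U^i-\overline{\mathbf U}_{Y^i}$, and let $\widetilde{\mathbf X}\in\mathbb R^{p_1\times\cdots\times p_M\times n}$, $\widetilde{\mathbf U}\in\mathbb R^{q\times n}$ collect them. Put $$\widehat{\boldsymbol\alpha}=\widetilde{\mathbf X}\times_{(M+1)}\{(\widetilde{\mathbf U}\widetilde{\mathbf U}^{\sf T})^{-1}\widetilde{\mathbf U}\},\quad \widehat{\boldsymbol\mu}_k=\overline{\mathbf X}_k-\widehat{\boldsymbol\alpha}\bar\times_{(M+1)}\overline{\mathbf U}_k,\quad \widehat{\mathbf E}^i=\widetilde{\mathbf X}^i-\widehat{\boldsymbol\alpha}\bar\times_{(M+1)}\widetilde{\mathbf U}^i,$$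 $$\widetilde{\mathbf S}_m=\Big(n\prod_{l\ne m}p_l\Big)^{-1}\sum_{i=1}^n\widehat{\mathbf E}^i_{(m)}(\widehat{\mathbf E}^i_{(m)})^{\sf T},\quad \widehat{\boldsymbol\Sigma}_m=\widetilde s_{m,11}^{-1}\widetilde{\mathbf S}_m\ (m<M),\quad \widehat{\boldsymbol\Sigma}_M=\frac{\widehat{\mathrm{var}}(X_{1\cdots1})}{\prod_{j=1}^M\widetilde s_{j,11}}\widetilde{\mathbf S}_M,$$ where $\mathbf A_{(m)}$ is the mode-$m$ matricization, $\widetilde s_{m,11}$ is the $(1,1)$ entry of $\widetilde{\mathbf S}_m$, and $\widehat{\mathrm{var}}$ is the sample variance. Let $\widehat{\boldsymbol\nu}_k=\mathrm{vec}(\widehat{\boldsymbol\mu}_k)$ (first index running fastest). **Problem.** For $\lambda>0$ and $\boldsymbol\beta=(\boldsymbol\beta_2,\dots,\boldsymbol\beta_K)^{\sf T}\in\mathbb R^{(K-1)\times p}$ with columns $\boldsymbol\beta_{\cdot j}$, consider $$\min_{\boldsymbol\beta}\ \sum_{k=2}^K\Big\{\boldsymbol\beta_k^{\sf T}(\widehat{\boldsymbol\Sigma}_M\otimes\cdots\otimes\widehat{\boldsymbol\Sigma}_1)\boldsymbol\beta_k-2(\widehat{\boldsymbol\nu}_k-\widehat{\boldsymbol\nu}_1)^{\sf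 T}\boldsymbol\beta_k\Big\}+\lambda\sum_{j=1}^p\|\boldsymbol\beta_{\cdot j}\|.\qquad(*)$$ **Algorithm.** Start from $\boldsymbol\beta^{(0)}=0$. In step $w=1,2,\dots$, update the columns $j=1,\dots,p$ one after the other, always using the current values of the other columns: with $(j_1,\dots,j_M)$ the multi-index of position $j$, $\widehat\sigma_{jj}=\prod_m\widehat\sigma_{m,j_mj_m}$ the product of the $(j_m,j_m)$ entries of the $\widehat{\boldsymbol\Sigma}_m$, $\widehat{\boldsymbol\Sigma}_{m,\cdot j_m}$ the $j_m$-th column of $\widehat{\boldsymbol\Sigma}_m$, and $\mathbf B_k^j$ the tensor whose vectorization is the current $\boldsymbol\beta_k$ with its $j$-th entry replaced by $0$, $$\widetilde\beta_{kj}=\frac{(\widehat\nu_{kj}-\widehat\nu_{1j})-[\![\mathbf B_k^j;\widehat{\boldsymbol\Sigma}_{1,\cdot j_1}^{\sf T},\dots,\widehat{\boldsymbol\Sigma}_{M,\cdot j_M}^{\sf T}]\!]}{\widehat\sigma_{jj}}\ (k=2,\dots,K),\qquad \boldsymbol\beta_{\cdot j}\leftarrow\widetilde{\boldsymbol\beta}_{\cdot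 j}\Big(1-\frac{\lambda}{2\widehat\sigma_{jj}\|\widetilde{\boldsymbol\beta}_{\cdot j}\|}\Big)_+$$ (read as $0$ if $\widetilde{\boldsymbol\beta}_{\cdot j}=0$). Let $\boldsymbol\beta^{(w)}$ be the array after step $w$. **Theorem.** If $(n-K-q)\prod_{j\ne m}p_j\ge p_m$ for every $m=1,\dots,M$ (without covariates, $q=0$, this is $(n-K)\prod_{j\ne m}p_j\ge p_m$), then with probability 1, for every $\lambda>0$, the problem $(*)$ has a unique global minimizer and $\boldsymbol\beta^{(w)}$ converges to it as $w\to\infty$. -/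

import Mathlib

open MeasureTheory ProbabilityTheory Filter Topology
open scoped MatrixOrder

noncomputable section

namespace Catch

/-! ### Tensors -/

/-- Multi-indices `(j_1, …, j_M)` of a `p_1 × ⋯ × p_M` tensor. -/
abbrev MIdx {M : ℕ} (p : Fin M → ℕ) : Type := (m : Fin M) → Fin (p m)

/-- Real `p_1 × ⋯ × p_M` tensors. -/
abbrev Tensor {M : ℕ} (p : Fin M → ℕ) : Type := MIdx p → ℝ

/-- The total dimension `p_1 ⋯ p_M`. -/
abbrev totalDim {M : ℕ} (p : Fin M → ℕ) : ℕ := ∏ m, p m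

/-- Vectorization: entry `(i_1, …, i_M)` goes to position `∑_k i_k ∏_{l < k} p_l` (counted from 0),
so the first index runs fastest. -/
def vec {M : ℕ} {p : Fin M → ℕ} (A : Tensor p) : Fin (totalDim p) → ℝ :=
  fun j => A (finPiFinEquiv.symm j)

/-- The inverse of vectorization. -/
def unvec {M : ℕ} {p : Fin M → ℕ} (b : Fin (totalDim p) → ℝ) : Tensor p :=
  fun i => b (finPiFinEquiv i)

/-- The Tucker product `⟦C; G_1, …, G_M⟧ = C ×_1 G_1 ×_2 ⋯ ×_M G_M`. -/
def tucker {M : ℕ} {p : Fin M → ℕ} {ι : Fin M → Type} (C : Tensor p)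
    (G : (m : Fin M) → Matrix (ι m) (Fin (p m)) ℝ) : ((m : Fin M) → ι m) → ℝ :=
  fun a => ∑ i : MIdx p, (∏ m, G m (a m) (i m)) * C i

/-- Mode-`m` matricization: rows are indexed by the `m`-th index, columns by the other ones. -/
def matricize {M : ℕ} {p : Fin M → ℕ} (m : Fin M) (A : Tensor p) :
    Matrix (Fin (p m)) ((l : {l : Fin M // l ≠ m}) → Fin (p l)) ℝ :=
  Matrix.of fun a r => A ((Equiv.piSplitAt m fun l => Fin (p l)).symm (a, r))

/-- The product `α ×̄_{M+1} u` of a `p_1 × ⋯ × p_M × q` tensor with a vector of length `q`. -/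
def modeVec {M q : ℕ} {p : Fin M → ℕ} (α : MIdx p → Fin q → ℝ) (u : EuclideanSpace ℝ (Fin q)) :
    Tensor p :=
  fun j => ∑ l, α j l * u l

/-- The Kronecker product `S_M ⊗ ⋯ ⊗ S_1`, acting on vectorized tensors. -/
def kron {M : ℕ} {p : Fin M → ℕ} (S : (m : Fin M) → Matrix (Fin (p m)) (Fin (p m)) ℝ) :
    Matrix (Fin (totalDim p)) (Fin (totalDim p)) ℝ :=
  Matrix.of fun a b => ∏ m, S m (finPiFinEquiv.symm a m) (finPiFinEquiv.symm b m)

/-! ### The CATCH model -/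

/-- The tensor normal law `TN(μ, Σ_1, …, Σ_M)`: the law of `μ + ⟦Z; Σ_1^{1/2}, …, Σ_M^{1/2}⟧`, where
the entries of `Z` are independent standard normal variables. -/
def tensorNormal {M : ℕ} {p : Fin M → ℕ} (μ : Tensor p)
    (S : (m : Fin M) → Matrix (Fin (p m)) (Fin (p m)) ℝ) : Measure (Tensor p) :=
  (Measure.pi fun _ : MIdx p => gaussianReal 0 1).map
    fun Z => μ + tucker Z fun m => CFC.sqrt (S m)

lemma measurable_tucker {M : ℕ} {p : Fin M → ℕ}
    (G : (m : Fin M) → Matrix (Fin (p m)) (Fin (p m)) ℝ) :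
    Measurable fun Z : Tensor p => tucker Z G := by
  unfold tucker
  fun_prop

lemma measurable_modeVec {M q : ℕ} {p : Fin M → ℕ} (α : MIdx p → Fin q → ℝ) :
    Measurable fun u : EuclideanSpace ℝ (Fin q) => modeVec α u := by
  unfold modeVec
  fun_prop

lemma measurable_tensorNormal {M : ℕ} {p : Fin M → ℕ}
    (S : (m : Fin M) → Matrix (Fin (p m)) (Fin (p m)) ℝ) :
    Measurable fun μ : Tensor p => tensorNormal μ S := by
  refine Measure.measurable_of_measurable_coe _ fun s hs => ?_
  have h : Measurable fun z : Tensor p × Tensor p => z.1 + tucker z.2 fun m => CFC.sqrt (S m) :=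
    measurable_fst.add ((measurable_tucker _).comp measurable_snd)
  have h2 := measurable_measure_prodMk_left
    (ν := Measure.pi fun _ : MIdx p => gaussianReal 0 1) (h hs)
  have h3 : (fun μ : Tensor p => tensorNormal μ S s) = fun μ : Tensor p =>
      (Measure.pi fun _ : MIdx p => gaussianReal 0 1)
        (Prod.mk μ ⁻¹' ((fun z : Tensor p × Tensor p =>
          z.1 + tucker z.2 fun m => CFC.sqrt (S m)) ⁻¹' s)) := by
    funext μ
    exact Measure.map_apply (Measurable.const_add (measurable_tucker _) μ) hs
  rw [h3]
  exact h2

instance isProbabilityMeasure_tensorNormal {M : ℕ} {p : Fin M → ℕ} (μ : Tensor p)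
    (S : (m : Fin M) → Matrix (Fin (p m)) (Fin (p m)) ℝ) :
    IsProbabilityMeasure (tensorNormal μ S) :=
  Measure.isProbabilityMeasure_map (Measurable.const_add (measurable_tucker _) μ).aemeasurable

/-- The conditional law of the covariates: `U ∣ Y = k` is `N(φ_k, Ψ)`. -/
def covariateKernel {K q : ℕ} (φ : Fin K → EuclideanSpace ℝ (Fin q))
    (Ψ : Matrix (Fin q) (Fin q) ℝ) : Kernel (Fin K) (EuclideanSpace ℝ (Fin q)) :=
  Kernel.ofFunOfCountable fun k => multivariateGaussian (φ k) Ψ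

/-- The conditional law of the tensor predictor:
`X ∣ (Y = k, U = u)` is `TN(μ_k + α ×̄_{M+1} u, Σ_1, …, Σ_M)`. -/
def tensorKernel {K q M : ℕ} {p : Fin M → ℕ} (μ : Fin K → Tensor p) (α : MIdx p → Fin q → ℝ)
    (S : (m : Fin M) → Matrix (Fin (p m)) (Fin (p m)) ℝ) :
    Kernel (Fin K × EuclideanSpace ℝ (Fin q)) (Tensor p) where
  toFun z := tensorNormal (μ z.1 + modeVec α z.2) S
  measurable' := (measurable_tensorNormal S).comp <|
    ((measurable_of_countable μ).comp measurable_fst).add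
      ((measurable_modeVec α).comp measurable_snd)

instance isMarkovKernel_covariateKernel {K q : ℕ} (φ : Fin K → EuclideanSpace ℝ (Fin q))
    (Ψ : Matrix (Fin q) (Fin q) ℝ) : IsMarkovKernel (covariateKernel φ Ψ) :=
  ⟨fun k => inferInstanceAs (IsProbabilityMeasure (multivariateGaussian (φ k) Ψ))⟩

instance isMarkovKernel_tensorKernel {K q M : ℕ} {p : Fin M → ℕ} (μ : Fin K → Tensor p)
    (α : MIdx p → Fin q → ℝ) (S : (m : Fin M) → Matrix (Fin (p m)) (Fin (p m)) ℝ) :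
    IsMarkovKernel (tensorKernel μ α S) :=
  ⟨fun z => isProbabilityMeasure_tensorNormal (μ z.1 + modeVec α z.2) S⟩

/-- The joint law of `((Y, U), X)` in the CATCH model with class probabilities `π`. -/
def catchLaw {K q M : ℕ} {p : Fin M → ℕ} (π : PMF (Fin K)) (φ : Fin K → EuclideanSpace ℝ (Fin q))
    (Ψ : Matrix (Fin q) (Fin q) ℝ) (μ : Fin K → Tensor p) (α : MIdx p → Fin q → ℝ)
    (S : (m : Fin M) → Matrix (Fin (p m)) (Fin (p m)) ℝ) :
    Measure ((Fin K × EuclideanSpace ℝ (Fin q)) × Tensor p) :=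
  (π.toMeasure.compProd (covariateKernel φ Ψ)).compProd (tensorKernel μ α S)

/-! ### Estimators

Throughout, `y i`, `u i`, `x i` are the label, the covariates and the tensor of observation `i`. -/

/-- The average of `v i` over the observations of class `k` (zero if there is none). -/
def classMean {n K : ℕ} {V : Type*} [AddCommGroup V] [Module ℝ V] (y : Fin n → Fin K)
    (v : Fin n → V) (k : Fin K) : V :=
  ((Finset.univ.filter fun i => y i = k).card : ℝ)⁻¹ •
    ∑ i ∈ Finset.univ.filter (fun i => y i = k), v i

/-- Observations centered within their class. -/
def centered {n K : ℕ} {V : Type*} [AddCommGroup V] [Module ℝ V] (y : Fin n → Fin K)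
    (v : Fin n → V) (i : Fin n) : V :=
  v i - classMean y v (y i)

/-- The `q × n` matrix `Ũ` of centered covariates. -/
def centeredU {n K q : ℕ} (y : Fin n → Fin K) (u : Fin n → EuclideanSpace ℝ (Fin q)) :
    Matrix (Fin q) (Fin n) ℝ :=
  Matrix.of fun l i => centered y u i l

/-- `α̂ = X̃ ×_{M+1} {(Ũ Ũᵀ)⁻¹ Ũ}`. -/
def alphaHat {n K q M : ℕ} {p : Fin M → ℕ} (y : Fin n → Fin K)
    (u : Fin n → EuclideanSpace ℝ (Fin q)) (x : Fin n → Tensor p) : MIdx p → Fin q → ℝ :=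
  fun j l => ∑ i, ((centeredU y u * (centeredU y u).transpose)⁻¹ * centeredU y u) l i *
    centered y x i j

/-- `μ̂_k = X̄_k - α̂ ×̄_{M+1} Ū_k`. -/
def muHat {n K q M : ℕ} {p : Fin M → ℕ} (y : Fin n → Fin K)
    (u : Fin n → EuclideanSpace ℝ (Fin q)) (x : Fin n → Tensor p) (k : Fin K) : Tensor p :=
  classMean y x k - modeVec (alphaHat y u x) (classMean y u k)

/-- The fitted residuals `Ê^i = (X^i - X̄_k) - α̂ ×̄_{M+1} (U^i - Ū_k)`, where `k = Y^i`. -/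
def residual {n K q M : ℕ} {p : Fin M → ℕ} (y : Fin n → Fin K)
    (u : Fin n → EuclideanSpace ℝ (Fin q)) (x : Fin n → Tensor p) (i : Fin n) : Tensor p :=
  centered y x i - modeVec (alphaHat y u x) (centered y u i)

/-- `S̃_m = (n ∏_{l ≠ m} p_l)⁻¹ ∑_i Ê^i_(m) (Ê^i_(m))ᵀ`. -/
def scatter {n K q M : ℕ} {p : Fin M → ℕ} (y : Fin n → Fin K)
    (u : Fin n → EuclideanSpace ℝ (Fin q)) (x : Fin n → Tensor p) (m : Fin M) :
    Matrix (Fin (p m)) (Fin (p m)) ℝ :=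
  ((n : ℝ) * ∏ l ∈ Finset.univ.erase m, (p l : ℝ))⁻¹ •
    ∑ i, matricize m (residual y u x i) * (matricize m (residual y u x i)).transpose

/-- The sample variance of the entry `X_{1⋯1}`. -/
def varFirst {n M : ℕ} {p : Fin M → ℕ} [∀ m, NeZero (p m)] (x : Fin n → Tensor p) : ℝ :=
  ((n : ℝ) - 1)⁻¹ * ∑ i, (x i (fun _ => 0) - (n : ℝ)⁻¹ * ∑ i', x i' (fun _ => 0)) ^ 2

/-- The covariance estimates: `Σ̂_m = s̃_{m,11}⁻¹ S̃_m` for `m < M`, and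
`Σ̂_M = (v̂ / ∏_m s̃_{m,11}) S̃_M` with `v̂` the sample variance of `X_{1⋯1}`. -/
def sigmaHat {n K q M : ℕ} {p : Fin M → ℕ} [∀ m, NeZero (p m)] (y : Fin n → Fin K)
    (u : Fin n → EuclideanSpace ℝ (Fin q)) (x : Fin n → Tensor p) (m : Fin M) :
    Matrix (Fin (p m)) (Fin (p m)) ℝ :=
  if (m : ℕ) + 1 = M then
    (varFirst x / ∏ l, scatter y u x l 0 0) • scatter y u x m
  else
    (scatter y u x m 0 0)⁻¹ • scatter y u x m

/-! ### The penalized problem and the algorithm -/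

/-- The non-baseline classes `2, …, K` (the baseline class `1` is `0 : Fin K`). -/
abbrev Rest (K : ℕ) [NeZero K] : Type := {k : Fin K // k ≠ 0}

/-- Coefficients `β = (β_2, …, β_K)ᵀ`, a `(K - 1) × p` array. -/
abbrev Coef {M : ℕ} (K : ℕ) [NeZero K] (p : Fin M → ℕ) : Type :=
  Rest K → Fin (totalDim p) → ℝ

/-- The objective
`∑_k {β_kᵀ (Σ_M ⊗ ⋯ ⊗ Σ_1) β_k - 2 (ν_k - ν_1)ᵀ β_k} + λ ∑_j ‖β_{·j}‖`, with `ν_k = vec μ_k`. -/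
def objective {M K : ℕ} [NeZero K] {p : Fin M → ℕ}
    (S : (m : Fin M) → Matrix (Fin (p m)) (Fin (p m)) ℝ) (μ : Fin K → Tensor p) (lam : ℝ)
    (β : Coef K p) : ℝ :=
  ∑ k, (β k ⬝ᵥ (kron S).mulVec (β k) - 2 * ((vec (μ k) - vec (μ 0)) ⬝ᵥ β k)) +
    lam * ∑ j, √(∑ k, β k j ^ 2)

/-- `β̃_{kj}`: the entry `j` of `ν_k - ν_1` minus `⟦B_k^j; Σ_{1,·j_1}ᵀ, …, Σ_{M,·j_M}ᵀ⟧`, divided by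
`∏_m σ_{m,j_m j_m}`. Here `B_k^j` is the tensor of `β_k` with its entry `j` replaced by zero, and
`(j_1, …, j_M)` is the multi-index of position `j`. -/
def betaTilde {M K : ℕ} [NeZero K] {p : Fin M → ℕ}
    (S : (m : Fin M) → Matrix (Fin (p m)) (Fin (p m)) ℝ) (μ : Fin K → Tensor p)
    (β : Coef K p) (j : Fin (totalDim p)) (k : Rest K) : ℝ :=
  let J : MIdx p := finPiFinEquiv.symm j
  ((vec (μ k) j - vec (μ 0) j) -
      tucker (ι := fun _ => Unit) (unvec (Function.update (β k) j 0))
        (fun m => Matrix.of fun _ i => S m i (J m)) (fun _ => ())) /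
    ∏ m, S m (J m) (J m)

/-- The update of block `j`: column `j` becomes
`β̃_{·j} (1 - (λ / (2 ∏_m σ_{m,j_m j_m})) / ‖β̃_{·j}‖)_+`, the other columns do not change. -/
def blockUpdate {M K : ℕ} [NeZero K] {p : Fin M → ℕ}
    (S : (m : Fin M) → Matrix (Fin (p m)) (Fin (p m)) ℝ) (μ : Fin K → Tensor p) (lam : ℝ)
    (β : Coef K p) (j : Fin (totalDim p)) : Coef K p :=
  let J : MIdx p := finPiFinEquiv.symm j
  fun k => Function.update (β k) j
    (betaTilde S μ β j k *
      max (1 - lam / (2 * ∏ m, S m (J m) (J m)) / √(∑ k', betaTilde S μ β j k' ^ 2)) 0)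

/-- One step of the algorithm: the blocks `j = 1, …, p` are updated one after the other, each time
using the current values of all the other blocks. -/
def sweep {M K : ℕ} [NeZero K] {p : Fin M → ℕ}
    (S : (m : Fin M) → Matrix (Fin (p m)) (Fin (p m)) ℝ) (μ : Fin K → Tensor p) (lam : ℝ)
    (β : Coef K p) : Coef K p :=
  (List.finRange (totalDim p)).foldl (blockUpdate S μ lam) β

/-- The iterate after `w` steps of blockwise coordinate descent started at zero. -/
def iterate {M K : ℕ} [NeZero K] {p : Fin M → ℕ}
    (S : (m : Fin M) → Matrix (Fin (p m)) (Fin (p m)) ℝ) (μ : Fin K → Tensor p) (lam : ℝ)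
    (w : ℕ) : Coef K p :=
  (sweep S μ lam)^[w] 0

end Catch

end

namespace Catch

/-! ### A convergence principle for descent maps -/

/-! The argument has a deterministic and a probabilistic half.

Deterministic half: if all `Σ̂_m` are positive definite, so is their Kronecker product `H`, and the
smooth part of the objective is a strictly convex quadratic. The penalty is a sum over columns, so a
point that is optimal in each column separately is the strict global minimizer
(`objective_lt_of_stationary`). A block update minimizes exactly over its column by group soft
thresholding, so a sweep is a continuous map that never raises the objective, and it preserves the
value only at a point fixed by all block updates, that is, at the minimizer. Along the iterates the
objective decreases to a limit. By continuity, a sweep started at a cluster point preserves the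
value, so the cluster point is the minimizer. Compact sublevel sets turn uniqueness of the cluster
point into convergence (`tendsto_iterate_of_descent`).

Probabilistic half: with labels and covariates fixed, the determinants of the `S̃_m` and the sample
variance are polynomials in the independent Gaussian errors. A nonzero polynomial vanishes only on a
null set, so one data set with nonzero value suffices for each. For `S̃_m` it exists by a dimension
count (`exists_det_scatter_ne_zero`): the residual operator on `ℝⁿ` has rank at least `n - K - q`,
so the residuals leave room for `p_m` independent rows as soon as `(n - K - q) ∏_{l ≠ m} p_l ≥ p_m`.
Fubini then averages over labels and covariates. The exceptional null set does not involve `λ`. -/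

theorem tendsto_iterate_of_descent {E : Type*} [TopologicalSpace E] {f : E → ℝ} {T : E → E}
    (hf : Continuous f) (hT : Continuous T) (hle : ∀ x, f (T x) ≤ f x)
    (hmin : ∀ x, f (T x) = f x → ∀ y, y ≠ x → f x < f y) (x₀ : E)
    (hc : IsCompact {x | f x ≤ f x₀}) :
    ∃ x, (∀ y, y ≠ x → f x < f y) ∧ Tendsto (fun w => T^[w] x₀) atTop (𝓝 x) := by
  have hanti : Antitone fun w => f (T^[w] x₀) := by
    refine antitone_nat_of_succ_le fun w => ?_
    rw [Function.iterate_succ_apply']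
    exact hle _
  have hmem : ∀ w, T^[w] x₀ ∈ {x | f x ≤ f x₀} := fun w => hanti (Nat.zero_le w)
  obtain ⟨z, -, hz⟩ := hc.exists_isMinOn ⟨x₀, le_refl (f x₀)⟩ hf.continuousOn
  have hbdd : BddBelow (Set.range fun w => f (T^[w] x₀)) :=
    ⟨f z, by rintro _ ⟨w, rfl⟩; exact hz (hmem w)⟩
  have hlim := tendsto_atTop_ciInf hanti hbdd
  set c := ⨅ w, f (T^[w] x₀)
  -- Continuity of `f` sends a cluster point of the iterates to a cluster point of their values,
  -- which converge to `c`. The same holds for `f ∘ T` along the shifted sequence.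
  have hval : ∀ x, MapClusterPt x atTop (fun w => T^[w] x₀) → f x = c := by
    intro x hx
    have h := hx.tendsto_comp hf.continuousAt.tendsto
    exact eq_of_nhds_neBot (h.neBot.mono (inf_le_inf_left _ hlim))
  have hval' : ∀ x, MapClusterPt x atTop (fun w => T^[w] x₀) → f (T x) = c := by
    intro x hx
    have h := hx.tendsto_comp (hf.comp hT).continuousAt.tendsto
    have hlim' : Tendsto ((f ∘ T) ∘ fun w => T^[w] x₀) atTop (𝓝 c) := by
      refine (hlim.comp (tendsto_add_atTop_nat 1)).congr fun w => ?_
      simp only [Function.comp_apply, Function.iterate_succ_apply']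
    exact eq_of_nhds_neBot (h.neBot.mono (inf_le_inf_left _ hlim'))
  have hstrict : ∀ x, MapClusterPt x atTop (fun w => T^[w] x₀) → ∀ y, y ≠ x → f x < f y :=
    fun x hx => hmin x ((hval' x hx).trans (hval x hx).symm)
  obtain ⟨x, -, hx⟩ := hc.exists_mapClusterPt (f := atTop) (u := fun w => T^[w] x₀)
    (tendsto_principal.2 (Eventually.of_forall hmem))
  refine ⟨x, hstrict x hx, ?_⟩
  refine hc.tendsto_nhds_of_unique_mapClusterPt (Eventually.of_forall hmem) fun y _ hy => ?_
  by_contra hne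
  exact lt_irrefl _ ((hstrict x hx y hne).trans (hstrict y hy x (Ne.symm hne)))

/-! ### Group soft thresholding -/

section SoftThreshold

variable {κ : Type*} [Fintype κ]

/-- The group soft-thresholding operator. -/
noncomputable def softThreshold (c : ℝ) (v : κ → ℝ) (k : κ) : ℝ :=
  v k * max (1 - c / √(∑ k', v k' ^ 2)) 0

lemma softThreshold_of_le {c : ℝ} {v : κ → ℝ} (h : √(∑ k, v k ^ 2) ≤ c) :
    softThreshold c v = 0 := by
  funext k
  -- At norm zero the quotient `c / 0` is `0` and the factor is `1`; the value is still `0` because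
  -- `v` vanishes.
  rcases (Real.sqrt_nonneg (∑ k, v k ^ 2)).eq_or_lt with h0 | h0
  · have h1 : ∑ k, v k ^ 2 = 0 :=
      (Real.sqrt_eq_zero (Finset.sum_nonneg fun _ _ => sq_nonneg _)).1 h0.symm
    have h2 := (Finset.sum_eq_zero_iff_of_nonneg fun k _ => sq_nonneg (v k)).1 h1 k
      (Finset.mem_univ k)
    simp [softThreshold, pow_eq_zero_iff two_ne_zero |>.1 h2]
  · have : 1 - c / √(∑ k, v k ^ 2) ≤ 0 := by
      rw [sub_nonpos, one_le_div h0]; exact h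
    simp [softThreshold, max_eq_right this]

/-- The denominator in this form is at least `c > 0`, which makes continuity visible even at `v =
0`. -/
lemma softThreshold_eq {c : ℝ} (hc : 0 < c) (v : κ → ℝ) (k : κ) :
    softThreshold c v k =
      v k * (max (√(∑ k', v k' ^ 2) - c) 0 / max (√(∑ k', v k' ^ 2)) c) := by
  rcases le_total (√(∑ k, v k ^ 2)) c with h | h
  · rw [softThreshold_of_le h, max_eq_right (sub_nonpos.2 h)]
    simp
  · have h0 := hc.trans_le h
    rw [max_eq_left (sub_nonneg.2 h), max_eq_left h, softThreshold, max_eq_left, sub_div,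
      div_self h0.ne']
    rw [sub_nonneg, div_le_one h0]
    exact h

lemma continuous_softThreshold {c : ℝ} (hc : 0 < c) :
    Continuous (softThreshold c : (κ → ℝ) → κ → ℝ) := by
  refine continuous_pi fun k => ?_
  simp only [softThreshold_eq hc]
  refine (continuous_apply k).mul (Continuous.div (by fun_prop) (by fun_prop) fun v => ?_)
  exact (hc.trans_le (le_max_right _ _)).ne'

/-- The variational inequality of the proximal map of `c‖·‖`: with `s` the thresholded vector, `v -
s` is a subgradient of `c‖·‖` at `s`, being `v` itself or `(c / ‖v‖) v`. Cauchy–Schwarz does the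
rest. -/
lemma sum_sub_softThreshold_mul_le {c : ℝ} (hc : 0 < c) (v w : κ → ℝ) :
    ∑ k, (v k - softThreshold c v k) * (w k - softThreshold c v k) ≤
      c * (√(∑ k, w k ^ 2) - √(∑ k, softThreshold c v k ^ 2)) := by
  have hcs := Real.sum_mul_le_sqrt_mul_sqrt Finset.univ v w
  rcases le_total (√(∑ k, v k ^ 2)) c with h | h
  · rw [softThreshold_of_le h]
    simp only [Pi.zero_apply, sub_zero, ne_eq, OfNat.ofNat_ne_zero, not_false_eq_true, zero_pow,
      Finset.sum_const_zero, Real.sqrt_zero]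
    exact hcs.trans (mul_le_mul_of_nonneg_right h (Real.sqrt_nonneg _))
  · set a := √(∑ k, v k ^ 2) with ha
    set b := √(∑ k, w k ^ 2)
    have h0 : 0 < a := hc.trans_le h
    have hs0 : 0 ≤ 1 - c / a := by rw [sub_nonneg, div_le_one h0]; exact h
    have hs : ∀ k, softThreshold c v k = (1 - c / a) * v k := fun k => by
      rw [softThreshold, ← ha, max_eq_left hs0, mul_comm]
    have hsq : ∑ k, v k ^ 2 = a ^ 2 :=
      (Real.sq_sqrt (Finset.sum_nonneg fun _ _ => sq_nonneg _)).symm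
    have hN : √(∑ k, softThreshold c v k ^ 2) = (1 - c / a) * a := by
      simp only [hs, mul_pow, ← Finset.mul_sum]
      rw [hsq, ← mul_pow, Real.sqrt_sq (mul_nonneg hs0 h0.le)]
    have hL : ∑ k, (v k - softThreshold c v k) * (w k - softThreshold c v k) =
        c / a * (∑ k, v k * w k - (1 - c / a) * a ^ 2) := by
      rw [← hsq, Finset.mul_sum, ← Finset.sum_sub_distrib, Finset.mul_sum]
      refine Finset.sum_congr rfl fun k _ => ?_
      rw [hs]; ring
    rw [hN, hL]
    have h1 : c / a * (∑ k, v k * w k - (1 - c / a) * a ^ 2) ≤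
        c / a * (a * b - (1 - c / a) * a ^ 2) := by
      gcongr
    refine h1.trans (le_of_eq ?_)
    field_simp

end SoftThreshold

/-! ### Kronecker products -/

section Kron

variable {M : ℕ} {p : Fin M → ℕ}

lemma kron_mul (A B : (m : Fin M) → Matrix (Fin (p m)) (Fin (p m)) ℝ) :
    kron A * kron B = kron fun m => A m * B m := by
  ext a b
  simp only [kron, Matrix.mul_apply, Matrix.of_apply, ← Finset.prod_mul_distrib]
  rw [finPiFinEquiv.symm.sum_comp
    (fun i : MIdx p => ∏ m, A m (finPiFinEquiv.symm a m) (i m) * B m (i m) (finPiFinEquiv.symm b m)),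
    Finset.prod_univ_sum, Fintype.piFinset_univ]

lemma kron_one : kron (fun m => (1 : Matrix (Fin (p m)) (Fin (p m)) ℝ)) = 1 := by
  ext a b
  simp only [kron, Matrix.of_apply, Matrix.one_apply, Finset.prod_ite_zero, Finset.prod_const_one]
  refine if_congr ⟨fun h => finPiFinEquiv.symm.injective (funext fun m => h m (Finset.mem_univ m)),
    fun h m _ => by rw [h]⟩ rfl rfl

lemma kron_transpose (A : (m : Fin M) → Matrix (Fin (p m)) (Fin (p m)) ℝ) :
    (kron A).transpose = kron fun m => (A m).transpose := rfl

lemma isUnit_kron {B : (m : Fin M) → Matrix (Fin (p m)) (Fin (p m)) ℝ}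
    (hB : ∀ m, IsUnit (B m)) : IsUnit (kron B) := by
  have hinv : kron B * kron (fun m => (B m)⁻¹) = 1 := by
    rw [kron_mul, ← kron_one]
    congr 1
    funext m
    exact Matrix.mul_nonsing_inv _ ((Matrix.isUnit_iff_isUnit_det _).1 (hB m))
  exact IsUnit.of_mul_eq_one _ hinv

lemma isUnit_sqrt_of_posDef {d : ℕ} {A : Matrix (Fin d) (Fin d) ℝ} (hA : A.PosDef) :
    IsUnit (CFC.sqrt A) := by
  have h : CFC.sqrt A * CFC.sqrt A = A := CFC.sqrt_mul_sqrt_self A hA.posSemidef.nonneg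
  have hu : IsUnit (CFC.sqrt A * CFC.sqrt A) := by rw [h]; exact hA.isUnit
  exact isUnit_of_mul_isUnit_left hu

/-- Multiplicativity of the Kronecker product factors it as `RᵀR`, where `R` is the product of the
square roots and is invertible. -/
lemma posDef_kron {S : (m : Fin M) → Matrix (Fin (p m)) (Fin (p m)) ℝ}
    (hS : ∀ m, (S m).PosDef) : (kron S).PosDef := by
  have h : kron S =
      (kron fun m => CFC.sqrt (S m)).conjTranspose * kron fun m => CFC.sqrt (S m) := by
    rw [Matrix.conjTranspose_eq_transpose_of_trivial, kron_transpose, kron_mul]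
    congr 1
    funext m
    have hH : (CFC.sqrt (S m)).IsHermitian :=
      (Matrix.nonneg_iff_posSemidef.1 (CFC.sqrt_nonneg (S m))).isHermitian
    rw [← Matrix.conjTranspose_eq_transpose_of_trivial, hH.eq,
      CFC.sqrt_mul_sqrt_self (S m) (hS m).posSemidef.nonneg]
  rw [h]
  exact Matrix.PosDef.conjTranspose_mul_self _ <| Matrix.mulVec_injective_of_isUnit <|
    isUnit_kron fun m => isUnit_sqrt_of_posDef (hS m)

end Kron

/-! ### Blockwise coordinate descent -/

section Descent

variable {M K : ℕ} [NeZero K] {p : Fin M → ℕ}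
  {S : (m : Fin M) → Matrix (Fin (p m)) (Fin (p m)) ℝ}

/-- Half the gradient of the smooth part of the objective. -/
noncomputable def halfGrad (S : (m : Fin M) → Matrix (Fin (p m)) (Fin (p m)) ℝ)
    (μ : Fin K → Tensor p) (β : Coef K p) (k : Rest K) (j : Fin (totalDim p)) : ℝ :=
  (kron S).mulVec (β k) j - (vec (μ k) j - vec (μ 0) j)

lemma kron_apply_self (j : Fin (totalDim p)) :
    ∏ m, S m (finPiFinEquiv.symm j m) (finPiFinEquiv.symm j m) = kron S j j := rfl

/-- Contracting with columns yields an entry of the transposed Kronecker matrix times `b`, whence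
the symmetry assumption. -/
lemma tucker_columns (hS : (kron S).IsSymm) (b : Fin (totalDim p) → ℝ) (j : Fin (totalDim p)) :
    tucker (ι := fun _ => Unit) (unvec b)
      (fun m => Matrix.of fun _ i => S m i (finPiFinEquiv.symm j m)) (fun _ => ()) =
      (kron S).mulVec b j := by
  simp only [tucker, unvec, Matrix.mulVec, dotProduct]
  rw [← finPiFinEquiv.sum_comp]
  refine Finset.sum_congr rfl fun i _ => ?_
  rw [← hS.apply]
  simp [kron]

/-- With the other entries of `β_k` fixed, the half-gradient is affine in `β_{kj}` with slope
`H_{jj}`, and `β̃_{kj}` is its root. -/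
lemma halfGrad_eq (hS : (kron S).PosDef) (μ : Fin K → Tensor p) (β : Coef K p) (k : Rest K)
    (j : Fin (totalDim p)) :
    halfGrad S μ β k j = kron S j j * (β k j - betaTilde S μ β j k) := by
  have hsymm : (kron S).IsSymm := Matrix.isHermitian_iff_isSymm.1 hS.isHermitian
  have hpos : 0 < kron S j j := hS.diag_pos
  simp only [betaTilde, kron_apply_self, tucker_columns hsymm, halfGrad]
  have h : (kron S).mulVec (Function.update (β k) j 0) j =
      (kron S).mulVec (β k) j - kron S j j * β k j := by
    have : Function.update (β k) j 0 = β k - Pi.single j (β k j) := by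
      funext i
      rcases eq_or_ne i j with rfl | hij <;> simp [*]
    rw [this, Matrix.mulVec_sub, Matrix.mulVec_single]
    simp [mul_comm]
  rw [h]
  field_simp
  ring

lemma blockUpdate_apply (μ : Fin K → Tensor p) (lam : ℝ) (β : Coef K p) (j : Fin (totalDim p))
    (k : Rest K) :
    blockUpdate S μ lam β j k = Function.update (β k) j
      (softThreshold (lam / (2 * kron S j j)) (betaTilde S μ β j) k) := rfl

/-- `β̃_{·j}` does not see column `j`, so after the update column `j` is the soft thresholding of
its own current `β̃_{·j}`. -/
lemma betaTilde_blockUpdate (μ : Fin K → Tensor p) (lam : ℝ) (β : Coef K p)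
    (j : Fin (totalDim p)) :
    betaTilde S μ (blockUpdate S μ lam β j) j = betaTilde S μ β j := by
  funext k
  simp only [betaTilde, blockUpdate_apply, Function.update_idem]

/-- First-order optimality in column `j`: the proximal inequality with threshold `λ / (2 H_{jj})`,
multiplied by `2 H_{jj}`. -/
lemma softThreshold_subgradient (hS : (kron S).PosDef) (μ : Fin K → Tensor p) {lam : ℝ}
    (hlam : 0 < lam) {β : Coef K p} {j : Fin (totalDim p)}
    (hβ : ∀ k, β k j = softThreshold (lam / (2 * kron S j j)) (betaTilde S μ β j) k)
    (w : Rest K → ℝ) :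
    0 ≤ 2 * ∑ k, (w k - β k j) * halfGrad S μ β k j +
      lam * (√(∑ k, w k ^ 2) - √(∑ k, β k j ^ 2)) := by
  have hpos : 0 < kron S j j := hS.diag_pos
  have h := sum_sub_softThreshold_mul_le (c := lam / (2 * kron S j j)) (by positivity)
    (betaTilde S μ β j) w
  simp only [← hβ] at h
  have h2 := mul_le_mul_of_nonneg_left h (by positivity : 0 ≤ 2 * kron S j j)
  have h3 : 2 * kron S j j * (lam / (2 * kron S j j) *
      (√(∑ k, w k ^ 2) - √(∑ k, β k j ^ 2))) = lam * (√(∑ k, w k ^ 2) - √(∑ k, β k j ^ 2)) := by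
    field_simp
  have h4 : 2 * ∑ k, (w k - β k j) * halfGrad S μ β k j =
      -(2 * kron S j j * ∑ k, (betaTilde S μ β j k - β k j) * (w k - β k j)) := by
    rw [Finset.mul_sum, Finset.mul_sum, ← Finset.sum_neg_distrib]
    refine Finset.sum_congr rfl fun k _ => ?_
    rw [halfGrad_eq hS]
    ring
  rw [h3] at h2
  rw [h4]
  linarith

/-- The smooth part is quadratic, so its second-order expansion is exact. What remains splits over
columns, which is why blockwise optimality implies global optimality. -/
lemma objective_sub_objective (hS : (kron S).PosDef) (μ : Fin K → Tensor p) (lam : ℝ)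
    (β β' : Coef K p) :
    objective S μ lam β' - objective S μ lam β =
      ∑ k, (β' k - β k) ⬝ᵥ (kron S).mulVec (β' k - β k) +
      ∑ j, (2 * ∑ k, (β' k j - β k j) * halfGrad S μ β k j +
        lam * (√(∑ k, β' k j ^ 2) - √(∑ k, β k j ^ 2))) := by
  have hsymm : (kron S).IsSymm := Matrix.isHermitian_iff_isSymm.1 hS.isHermitian
  have hk : ∀ k, (β' k ⬝ᵥ (kron S).mulVec (β' k) - 2 * ((vec (μ k) - vec (μ 0)) ⬝ᵥ β' k)) -
      (β k ⬝ᵥ (kron S).mulVec (β k) - 2 * ((vec (μ k) - vec (μ 0)) ⬝ᵥ β k)) =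
      (β' k - β k) ⬝ᵥ (kron S).mulVec (β' k - β k) +
        2 * ∑ j, (β' k j - β k j) * halfGrad S μ β k j := by
    intro k
    have h1 : ∑ j, (β' k j - β k j) * halfGrad S μ β k j =
        (β' k - β k) ⬝ᵥ ((kron S).mulVec (β k) - (vec (μ k) - vec (μ 0))) := rfl
    have h2 : β k ⬝ᵥ (kron S).mulVec (β' k) = β' k ⬝ᵥ (kron S).mulVec (β k) := by
      rw [Matrix.dotProduct_mulVec, dotProduct_comm, ← Matrix.mulVec_transpose, hsymm.eq]
    rw [h1, Matrix.mulVec_sub]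
    simp only [sub_dotProduct, dotProduct_sub]
    rw [h2, dotProduct_comm (vec (μ k)) (β' k), dotProduct_comm (vec (μ k)) (β k),
      dotProduct_comm (vec (μ 0)) (β' k), dotProduct_comm (vec (μ 0)) (β k)]
    ring
  rw [objective, objective, add_sub_add_comm, ← Finset.sum_sub_distrib,
    Finset.sum_congr rfl fun k _ => hk k, Finset.sum_add_distrib, Finset.sum_add_distrib,
    ← mul_sub, ← Finset.sum_sub_distrib, ← Finset.mul_sum, ← Finset.mul_sum, ← Finset.mul_sum,
    Finset.sum_comm (γ := Rest K), add_assoc]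

/-- The alternative in each column serves two purposes: all columns stationary gives global
optimality, and a single stationary column with the others unchanged gives strict descent of a block
update. -/
lemma objective_lt_of_stationary (hS : (kron S).PosDef) (μ : Fin K → Tensor p) {lam : ℝ}
    (hlam : 0 < lam) {β β' : Coef K p} (hne : β' ≠ β)
    (h : ∀ j, (∀ k, β' k j = β k j) ∨
      ∀ k, β k j = softThreshold (lam / (2 * kron S j j)) (betaTilde S μ β j) k) :
    objective S μ lam β < objective S μ lam β' := by
  rw [← sub_pos, objective_sub_objective hS]
  refine add_pos_of_pos_of_nonneg ?_ (Finset.sum_nonneg fun j _ => ?_)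
  · obtain ⟨k, hk⟩ := Function.ne_iff.1 hne
    refine Finset.sum_pos' (fun k _ => ?_) ⟨k, Finset.mem_univ k, ?_⟩
    · simpa using hS.posSemidef.dotProduct_mulVec_nonneg (β' k - β k)
    · simpa using hS.dotProduct_mulVec_pos (sub_ne_zero.2 hk)
  · rcases h j with h | h
    · simp [h]
    · exact softThreshold_subgradient hS μ hlam h fun k => β' k j

lemma objective_blockUpdate_lt (hS : (kron S).PosDef) (μ : Fin K → Tensor p) {lam : ℝ}
    (hlam : 0 < lam) {β : Coef K p} {j : Fin (totalDim p)} (hne : blockUpdate S μ lam β j ≠ β) :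
    objective S μ lam (blockUpdate S μ lam β j) < objective S μ lam β := by
  -- The base point of the expansion is the updated array; the old one is the competitor.
  refine objective_lt_of_stationary hS μ hlam hne.symm fun i => ?_
  rcases eq_or_ne i j with rfl | hij
  · right
    intro k
    rw [betaTilde_blockUpdate, blockUpdate_apply, Function.update_self]
  · left
    intro k
    rw [blockUpdate_apply, Function.update_of_ne hij]

/-- The first block that really moves makes the objective drop strictly, and later blocks cannot
undo this. Equality therefore means that none moves, each being tested at the same `β`. -/
lemma objective_foldl_blockUpdate (hS : (kron S).PosDef) (μ : Fin K → Tensor p) {lam : ℝ}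
    (hlam : 0 < lam) (l : List (Fin (totalDim p))) (β : Coef K p) :
    objective S μ lam (l.foldl (blockUpdate S μ lam) β) ≤ objective S μ lam β ∧
      (objective S μ lam (l.foldl (blockUpdate S μ lam) β) = objective S μ lam β →
        ∀ j ∈ l, blockUpdate S μ lam β j = β) := by
  induction l generalizing β with
  | nil => simp
  | cons i l ih =>
    rw [List.foldl_cons]
    by_cases hi : blockUpdate S μ lam β i = β
    · rw [hi]
      refine ⟨(ih β).1, fun h j hj => ?_⟩
      rcases List.mem_cons.1 hj with rfl | hj
      · exact hi
      · exact (ih β).2 h j hj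
    · have h1 := (ih (blockUpdate S μ lam β i)).1.trans_lt (objective_blockUpdate_lt hS μ hlam hi)
      exact ⟨h1.le, fun h => absurd h h1.ne⟩

lemma continuous_objective (μ : Fin K → Tensor p) (lam : ℝ) :
    Continuous (objective S μ lam : Coef K p → ℝ) := by
  unfold objective
  simp only [Matrix.mulVec, dotProduct]
  fun_prop

lemma continuous_blockUpdate (hS : (kron S).PosDef) (μ : Fin K → Tensor p) {lam : ℝ}
    (hlam : 0 < lam) (j : Fin (totalDim p)) :
    Continuous fun β : Coef K p => blockUpdate S μ lam β j := by
  have hpos : 0 < kron S j j := hS.diag_pos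
  have hb : Continuous fun β : Coef K p => betaTilde S μ β j := by
    refine continuous_pi fun k => ?_
    have : (fun β : Coef K p => betaTilde S μ β j k) = fun β =>
        β k j - halfGrad S μ β k j / kron S j j := by
      funext β
      rw [halfGrad_eq hS]
      field_simp
      ring
    rw [this]
    unfold halfGrad
    simp only [Matrix.mulVec, dotProduct]
    fun_prop
  have hs := (continuous_softThreshold (κ := Rest K)
    (by positivity : 0 < lam / (2 * kron S j j))).comp hb
  refine continuous_pi fun k => ?_
  simp only [blockUpdate_apply]
  exact (continuous_apply k).update j ((continuous_apply k).comp hs)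

lemma continuous_sweep (hS : (kron S).PosDef) (μ : Fin K → Tensor p) {lam : ℝ}
    (hlam : 0 < lam) : Continuous (sweep S μ lam : Coef K p → Coef K p) := by
  unfold sweep
  generalize List.finRange (totalDim p) = l
  induction l with
  | nil => exact continuous_id
  | cons i l ih => exact ih.comp (continuous_blockUpdate hS μ hlam i)

lemma isCompact_sublevel_objective (hS : (kron S).PosDef) (μ : Fin K → Tensor p) {lam : ℝ}
    (hlam : 0 < lam) (c : ℝ) : IsCompact {β : Coef K p | objective S μ lam β ≤ c} := by
  have hsymm : (kron S).IsSymm := Matrix.isHermitian_iff_isSymm.1 hS.isHermitian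
  obtain ⟨C, hC⟩ : ∃ C : ℝ, ∀ β : Coef K p,
      -C ≤ ∑ k, (β k ⬝ᵥ (kron S).mulVec (β k) - 2 * ((vec (μ k) - vec (μ 0)) ⬝ᵥ β k)) := by
    -- Completing the square: `-dᵀH⁻¹d` is the minimum of the quadratic for class `k`, attained at
    -- `z = H⁻¹d`. On a sublevel set the penalty is then at most `c + C`.
    refine ⟨∑ k : Rest K, ((kron S)⁻¹.mulVec (vec (μ k) - vec (μ 0))) ⬝ᵥ
      (vec (μ k) - vec (μ 0)), fun β => ?_⟩
    rw [← Finset.sum_neg_distrib]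
    refine Finset.sum_le_sum fun k _ => ?_
    set d := vec (μ k) - vec (μ 0)
    set z := (kron S)⁻¹.mulVec d with hz
    have hHz : (kron S).mulVec z = d := by
      rw [hz, Matrix.mulVec_mulVec, Matrix.mul_nonsing_inv _
        ((Matrix.isUnit_iff_isUnit_det _).1 hS.isUnit), Matrix.one_mulVec]
    have h := hS.posSemidef.dotProduct_mulVec_nonneg (β k - z)
    have h2 : z ⬝ᵥ (kron S).mulVec (β k) = d ⬝ᵥ β k := by
      rw [← hHz, Matrix.dotProduct_mulVec, ← Matrix.mulVec_transpose, hsymm.eq]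
    simp only [star_trivial, Matrix.mulVec_sub, hHz, sub_dotProduct, dotProduct_sub, h2,
      dotProduct_comm (β k) d] at h
    linarith
  refine (isCompact_univ_pi fun k => isCompact_univ_pi fun j =>
    isCompact_Icc (a := -((c + C) / lam)) (b := (c + C) / lam)).of_isClosed_subset
    (isClosed_le (continuous_objective μ lam) continuous_const) fun β hβ => ?_
  simp only [Set.mem_pi, Set.mem_univ, true_implies, Set.mem_Icc, ← abs_le]
  intro k j
  have h1 : |β k j| ≤ √(∑ k, β k j ^ 2) := by
    rw [← Real.sqrt_sq_eq_abs]
    exact Real.sqrt_le_sqrt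
      (Finset.single_le_sum (f := fun k => β k j ^ 2) (fun _ _ => sq_nonneg _) (Finset.mem_univ k))
  have h2 : √(∑ k, β k j ^ 2) ≤ ∑ j, √(∑ k, β k j ^ 2) :=
    Finset.single_le_sum (f := fun j => √(∑ k, β k j ^ 2)) (fun _ _ => Real.sqrt_nonneg _)
      (Finset.mem_univ j)
  have h3 : objective S μ lam β ≤ c := hβ
  rw [objective] at h3
  rw [le_div_iff₀ hlam]
  have h4 := mul_le_mul_of_nonneg_left (h1.trans h2) hlam.le
  linarith [hC β]

theorem exists_unique_minimizer_and_tendsto_iterate (hS : ∀ m, (S m).PosDef)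
    (μ : Fin K → Tensor p) {lam : ℝ} (hlam : 0 < lam) :
    ∃ β : Coef K p, (∀ β', β' ≠ β → objective S μ lam β < objective S μ lam β') ∧
      Tendsto (fun w => iterate S μ lam w) atTop (𝓝 β) := by
  have hk := posDef_kron hS
  refine tendsto_iterate_of_descent (continuous_objective μ lam) (continuous_sweep hk μ hlam)
    (fun β => (objective_foldl_blockUpdate hk μ hlam _ β).1) (fun β h β' hne => ?_) 0
    (isCompact_sublevel_objective hk μ hlam _)
  refine objective_lt_of_stationary hk μ hlam hne fun j => Or.inr fun k => ?_
  have hj := (objective_foldl_blockUpdate hk μ hlam _ β).2 h j (List.mem_finRange j)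
  have hkj := congrFun (congrFun hj k) j
  rw [blockUpdate_apply, Function.update_self] at hkj
  exact hkj.symm

end Descent

/-! ### Zero sets of polynomials -/

/-- Induction on the number of variables: for almost all values of the others, some coefficient with
respect to the first variable is nonzero, so only finitely many roots remain, a null set for an
atomless measure. -/
lemma ae_eval_ne_zero_fin (ν : Measure ℝ) [SigmaFinite ν] [NullSingletonClass ν] {d : ℕ}
    {f : MvPolynomial (Fin d) ℝ} (hf : f ≠ 0) :
    ∀ᵐ z ∂(Measure.pi fun _ : Fin d => ν), MvPolynomial.eval z f ≠ 0 := by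
  induction d with
  | zero =>
    refine ae_of_all _ fun z hz => hf (MvPolynomial.funext fun z' => ?_)
    rw [Subsingleton.elim z' z, hz, map_zero]
  | succ d ih =>
    have hmp := measurePreserving_piFinSuccAbove (fun _ : Fin (d + 1) => ν) 0
    have hcont : Measurable fun z : Fin (d + 1) → ℝ => MvPolynomial.eval z f :=
      (MvPolynomial.continuous_eval f).measurable
    have hset : MeasurableSet {z : Fin (d + 1) → ℝ | MvPolynomial.eval z f ≠ 0} :=
      hcont (measurableSet_singleton 0).compl
    have hsymm : Measurable fun x : ℝ × (Fin d → ℝ) => (Fin.cons x.1 x.2 : Fin (d + 1) → ℝ) := by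
      refine measurable_pi_lambda _ fun i => ?_
      refine Fin.cases ?_ (fun j => ?_) i
      · simpa using measurable_fst
      · simpa [Function.comp_def] using (measurable_pi_apply j).comp measurable_snd
    have hset' : MeasurableSet {x : ℝ × (Fin d → ℝ) |
        MvPolynomial.eval (Fin.cons x.1 x.2 : Fin (d + 1) → ℝ) f ≠ 0} := hsymm hset
    have key : ∀ᵐ x ∂ν.prod (Measure.pi fun _ : Fin d => ν),
        MvPolynomial.eval (Fin.cons x.1 x.2 : Fin (d + 1) → ℝ) f ≠ 0 := by
      -- The factors are swapped so that Fubini fixes the last `d` coordinates first, where the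
      -- induction hypothesis applies.
      rw [← Measure.prod_swap, ae_map_iff measurable_swap.aemeasurable hset',
        Measure.ae_prod_iff_ae_ae (p := fun x : (Fin d → ℝ) × ℝ =>
          MvPolynomial.eval (Fin.cons x.swap.1 x.swap.2 : Fin (d + 1) → ℝ) f ≠ 0)
          (measurable_swap hset')]
      have hne : MvPolynomial.finSuccEquiv ℝ d f ≠ 0 := by
        simpa using hf
      obtain ⟨k, hk⟩ : ∃ k, (MvPolynomial.finSuccEquiv ℝ d f).coeff k ≠ 0 := by
        by_contra! h
        exact hne (Polynomial.ext h)
      filter_upwards [ih hk] with s hs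
      have hpoly : Polynomial.map (MvPolynomial.eval s) (MvPolynomial.finSuccEquiv ℝ d f) ≠ 0 := by
        intro h
        have := congrArg (fun q => Polynomial.coeff q k) h
        simp only [Polynomial.coeff_map, Polynomial.coeff_zero] at this
        exact hs this
      have hfin := (Polynomial.finite_setOfPred_isRoot hpoly).measure_zero ν
      refine measure_mono_null (fun t ht => ?_) hfin
      simpa [MvPolynomial.eval_eq_eval_mv_eval', Polynomial.IsRoot] using ht
    have h2 := hmp.quasiMeasurePreserving.ae key
    filter_upwards [h2] with z hz
    have hz' : (Fin.cons (z 0) (fun j => z (Fin.succ j)) : Fin (d + 1) → ℝ) = z :=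
      Fin.cons_self_tail z
    rw [← hz']
    exact hz

lemma ae_eval_ne_zero (ν : Measure ℝ) [SigmaFinite ν] [NullSingletonClass ν] {ι : Type*} [Fintype ι]
    {f : MvPolynomial ι ℝ} (hf : f ≠ 0) :
    ∀ᵐ z ∂(Measure.pi fun _ : ι => ν), MvPolynomial.eval z f ≠ 0 := by
  let e := Fintype.equivFin ι
  have hmp := measurePreserving_piCongrLeft (fun _ : Fin (Fintype.card ι) => ν) e
  have hne : MvPolynomial.rename e f ≠ 0 := by
    rw [Ne, MvPolynomial.rename_eq_zero_iff_of_injective _ e.injective]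
    exact hf
  filter_upwards [hmp.quasiMeasurePreserving.ae (ae_eval_ne_zero_fin ν hne)] with z hz
  rw [MvPolynomial.eval_rename] at hz
  convert hz using 2
  congr 1
  funext i
  exact (MeasurableEquiv.piCongrLeft_apply_apply (β := fun _ => ℝ) e z i).symm

/-- The algebra of polynomial functions of a doubly indexed array. -/
noncomputable def polyFun (ι κ : Type*) : Subalgebra ℝ ((ι → κ → ℝ) → ℝ) :=
  (MvPolynomial.aeval fun (a : ι × κ) (z : ι → κ → ℝ) => z a.1 a.2).range

section PolyFun

variable {ι κ : Type*}

lemma coord_mem_polyFun (i : ι) (k : κ) : (fun z : ι → κ → ℝ => z i k) ∈ polyFun ι κ :=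
  ⟨MvPolynomial.X (i, k), by simp⟩

lemma const_mem_polyFun (c : ℝ) : (fun _ : ι → κ → ℝ => c) ∈ polyFun ι κ :=
  (polyFun ι κ).algebraMap_mem c

lemma add_mem_polyFun {f g : (ι → κ → ℝ) → ℝ} (hf : f ∈ polyFun ι κ) (hg : g ∈ polyFun ι κ) :
    (fun z => f z + g z) ∈ polyFun ι κ := (polyFun ι κ).add_mem hf hg

lemma sub_mem_polyFun {f g : (ι → κ → ℝ) → ℝ} (hf : f ∈ polyFun ι κ) (hg : g ∈ polyFun ι κ) :
    (fun z => f z - g z) ∈ polyFun ι κ := (polyFun ι κ).sub_mem hf hg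

lemma mul_mem_polyFun {f g : (ι → κ → ℝ) → ℝ} (hf : f ∈ polyFun ι κ) (hg : g ∈ polyFun ι κ) :
    (fun z => f z * g z) ∈ polyFun ι κ := (polyFun ι κ).mul_mem hf hg

lemma const_mul_mem_polyFun (c : ℝ) {f : (ι → κ → ℝ) → ℝ} (hf : f ∈ polyFun ι κ) :
    (fun z => c * f z) ∈ polyFun ι κ := mul_mem_polyFun (const_mem_polyFun c) hf

lemma sum_mem_polyFun {σ : Type*} (s : Finset σ) {f : σ → (ι → κ → ℝ) → ℝ}
    (hf : ∀ a, f a ∈ polyFun ι κ) : (fun z => ∑ a ∈ s, f a z) ∈ polyFun ι κ := by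
  have := (polyFun ι κ).sum_mem (t := s) fun a _ => hf a
  rwa [Finset.sum_fn] at this

lemma det_mem_polyFun {d : ℕ} {A : (ι → κ → ℝ) → Matrix (Fin d) (Fin d) ℝ}
    (hA : ∀ a b, (fun z => A z a b) ∈ polyFun ι κ) :
    (fun z => (A z).det) ∈ polyFun ι κ := by
  simp only [Matrix.det_apply']
  refine sum_mem_polyFun _ fun σ => const_mul_mem_polyFun _ ?_
  have := (polyFun ι κ).prod_mem (t := Finset.univ) fun a _ => hA (σ a) a
  rwa [Finset.prod_fn] at this

lemma ae_ne_zero_of_mem_polyFun [Fintype ι] [Fintype κ] (ν : Measure ℝ) [IsProbabilityMeasure ν]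
    [NullSingletonClass ν] {f : (ι → κ → ℝ) → ℝ} (hf : f ∈ polyFun ι κ) {z₀ : ι → κ → ℝ} (hz₀ : f z₀ ≠ 0) :
    ∀ᵐ z ∂(Measure.pi fun _ : ι => Measure.pi fun _ : κ => ν), f z ≠ 0 := by
  obtain ⟨g, rfl⟩ := hf
  have heval : ∀ z : ι → κ → ℝ,
      MvPolynomial.aeval (fun (a : ι × κ) (z : ι → κ → ℝ) => z a.1 a.2) g z =
        MvPolynomial.eval (fun a : ι × κ => z a.1 a.2) g := by
    intro z
    clear hz₀
    induction g using MvPolynomial.induction_on with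
    | C a => simp
    | add p q hp hq => simp_all
    | mul_X p i hp => simp_all
  have hg : g ≠ 0 := by
    rintro rfl
    simp at hz₀
  have h := ae_eval_ne_zero ν hg
  have hmap := Measure.infinitePi_map_curry_symm (fun (_ : ι) (_ : κ) => ν)
  simp only [Measure.infinitePi_eq_pi] at hmap
  rw [← hmap] at h
  filter_upwards [ae_of_ae_map (MeasurableEquiv.measurable _).aemeasurable h] with z hz
  rw [AlgHom.toRingHom_eq_coe, RingHom.coe_coe, heval]
  exact hz

end PolyFun

/-! ### Residuals -/

section Residual

variable {n K q M : ℕ} {p : Fin M → ℕ}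

lemma centered_tensor_apply (y : Fin n → Fin K) (x : Fin n → Tensor p) (i : Fin n) (j : MIdx p) :
    centered y x i j = centered y (fun i => x i j) i := by
  simp [centered, classMean]

lemma centered_euclidean_apply (y : Fin n → Fin K) (u : Fin n → EuclideanSpace ℝ (Fin q))
    (i : Fin n) (l : Fin q) : centered y u i l = centered y (fun i => u i l) i := by
  simp [centered, classMean]

/-- Centering within classes, as a linear map. -/
noncomputable def centeredMap (y : Fin n → Fin K) : (Fin n → ℝ) →ₗ[ℝ] (Fin n → ℝ) where
  toFun w := centered y w
  map_add' v w := by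
    funext i
    simp only [centered, classMean, Pi.add_apply, Finset.sum_add_distrib, smul_eq_mul]
    ring
  map_smul' c w := by
    funext i
    simp only [centered, classMean, Pi.smul_apply, smul_eq_mul, ← Finset.mul_sum, RingHom.id_apply]
    ring

/-- The linear map taking the observed values of one tensor entry to its residuals. -/
noncomputable def residualMap (y : Fin n → Fin K) (u : Fin n → EuclideanSpace ℝ (Fin q)) :
    (Fin n → ℝ) →ₗ[ℝ] (Fin n → ℝ) :=
  centeredMap y - (centeredU y u).transpose.mulVecLin ∘ₗ
    ((centeredU y u * (centeredU y u).transpose)⁻¹ * centeredU y u).mulVecLin ∘ₗ centeredMap y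

/-- Every tensor entry is processed by the same linear map on `ℝⁿ`, depending only on labels and
covariates. -/
lemma residual_apply (y : Fin n → Fin K) (u : Fin n → EuclideanSpace ℝ (Fin q))
    (x : Fin n → Tensor p) (i : Fin n) (j : MIdx p) :
    residual y u x i j = residualMap y u (fun i => x i j) i := by
  simp only [residual, residualMap, modeVec, alphaHat, Pi.sub_apply, LinearMap.sub_apply,
    centered_tensor_apply, LinearMap.comp_apply, Matrix.mulVecLin_apply]
  congr 1
  simp only [Matrix.mulVec, dotProduct, Matrix.transpose_apply, centeredMap, LinearMap.coe_mk,
    AddHom.coe_mk]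
  refine Finset.sum_congr rfl fun l _ => ?_
  rw [mul_comm]
  rfl

/-- A vector with zero residuals is a class-wise constant plus a combination of the rows of `Ũ`, so
the kernel has dimension at most `K + q`. This holds whether or not `Ũ Ũᵀ` is invertible. -/
lemma le_finrank_range_residualMap (y : Fin n → Fin K) (u : Fin n → EuclideanSpace ℝ (Fin q)) :
    n ≤ Module.finrank ℝ (LinearMap.range (residualMap y u)) + (K + q) := by
  let T : (Fin K → ℝ) × (Fin q → ℝ) →ₗ[ℝ] (Fin n → ℝ) :=
    (LinearMap.funLeft ℝ ℝ y).coprod (centeredU y u).transpose.mulVecLin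
  have hker : LinearMap.ker (residualMap y u) ≤ LinearMap.range T := by
    intro w hw
    rw [LinearMap.mem_ker] at hw
    refine ⟨(classMean y w, ((centeredU y u * (centeredU y u).transpose)⁻¹ *
      centeredU y u).mulVecLin (centeredMap y w)), ?_⟩
    funext i
    have h := congrFun hw i
    simp only [residualMap, LinearMap.sub_apply, LinearMap.comp_apply, Pi.sub_apply,
      Pi.zero_apply, sub_eq_zero] at h
    simp only [T, LinearMap.coprod_apply, Pi.add_apply, LinearMap.funLeft_apply]
    rw [← h]
    simp [centeredMap, centered]
  have h1 := (residualMap y u).finrank_range_add_finrank_ker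
  have h2 := (Submodule.finrank_mono hker).trans (LinearMap.finrank_range_le T)
  simp only [Module.finrank_prod, Module.finrank_fin_fun] at h1 h2
  omega

end Residual

/-! ### Scatter matrices -/

section Scatter

variable {n K q M : ℕ} {p : Fin M → ℕ}

lemma posSemidef_scatter (y : Fin n → Fin K) (u : Fin n → EuclideanSpace ℝ (Fin q))
    (x : Fin n → Tensor p) (m : Fin M) : (scatter y u x m).PosSemidef := by
  refine Matrix.PosSemidef.smul (Matrix.posSemidef_sum _ fun i _ => ?_) (by positivity)
  rw [← Matrix.conjTranspose_eq_transpose_of_trivial]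
  exact Matrix.posSemidef_self_mul_conjTranspose _

/-- Up to a positive factor, `vᵀ S̃_m v` is the sum of the squared norms of the `vᵀ Ê^i_(m)`. -/
lemma residual_eq_zero_of_scatter_mulVec [∀ m, NeZero (p m)] (hn : n ≠ 0) {y : Fin n → Fin K}
    {u : Fin n → EuclideanSpace ℝ (Fin q)} {x : Fin n → Tensor p} {m : Fin M}
    {v : Fin (p m) → ℝ} (hv : (scatter y u x m).mulVec v = 0) (i : Fin n) :
    Matrix.vecMul v (matricize m (residual y u x i)) = 0 := by
  set A := fun i => matricize m (residual y u x i)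
  have hc : (n : ℝ) * ∏ l ∈ Finset.univ.erase m, (p l : ℝ) ≠ 0 :=
    mul_ne_zero (Nat.cast_ne_zero.2 hn)
      (Finset.prod_ne_zero_iff.2 fun l _ => Nat.cast_ne_zero.2 (NeZero.ne _))
  rw [scatter, Matrix.smul_mulVec, smul_eq_zero_iff_right (inv_ne_zero hc)] at hv
  have h : ∑ i, Matrix.vecMul v (A i) ⬝ᵥ Matrix.vecMul v (A i) = 0 := by
    have h1 : v ⬝ᵥ (∑ i, A i * (A i).transpose).mulVec v = 0 := by rw [hv, dotProduct_zero]
    rw [← h1, Matrix.sum_mulVec, dotProduct_sum]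
    refine Finset.sum_congr rfl fun i _ => ?_
    rw [← Matrix.mulVec_mulVec, Matrix.dotProduct_mulVec, Matrix.mulVec_transpose]
  have hi := (Finset.sum_eq_zero_iff_of_nonneg fun i _ => by
    simpa using dotProduct_star_self_nonneg (Matrix.vecMul v (A i))).1 h i (Finset.mem_univ i)
  exact dotProduct_self_eq_zero.1 hi

lemma exists_det_scatter_ne_zero [∀ m, NeZero (p m)] (y : Fin n → Fin K)
    (u : Fin n → EuclideanSpace ℝ (Fin q)) (m : Fin M)
    (hdim : (p m : ℤ) ≤ ((n : ℤ) - K - q) * ∏ l ∈ Finset.univ.erase m, (p l : ℤ)) :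
    ∃ x : Fin n → Tensor p, (scatter y u x m).det ≠ 0 := by
  have hprod : 0 < ∏ l ∈ Finset.univ.erase m, (p l : ℤ) :=
    Finset.prod_pos fun l _ => by exact_mod_cast Nat.pos_of_ne_zero (NeZero.ne (p l))
  have hpm : 0 < (p m : ℤ) := by exact_mod_cast Nat.pos_of_ne_zero (NeZero.ne (p m))
  -- As `p_m ≥ 1`, the dimension condition itself excludes a nonpositive `n - K - q`.
  have hpos : 0 < (n : ℤ) - K - q := pos_of_mul_pos_left (hpm.trans_le hdim) hprod.le
  have hn : n ≠ 0 := by omega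
  have hcard : Fintype.card ((l : {l : Fin M // l ≠ m}) → Fin (p l)) =
      ∏ l ∈ Finset.univ.erase m, p l := by
    rw [Fintype.card_pi]
    simp only [Fintype.card_fin]
    exact (Finset.prod_subtype (Finset.univ.erase m) (by simp) p).symm
  have hle : p m ≤ Module.finrank ℝ
      (((l : {l : Fin M // l ≠ m}) → Fin (p l)) → LinearMap.range (residualMap y u)) := by
    rw [Module.finrank_pi_fintype, Finset.sum_const, Finset.card_univ, hcard, smul_eq_mul]
    have h1 := le_finrank_range_residualMap y u
    have h2 : (n : ℤ) - K - q ≤ Module.finrank ℝ (LinearMap.range (residualMap y u)) := by omega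
    have h3 := hdim.trans (mul_le_mul_of_nonneg_right h2 hprod.le)
    rw [mul_comm]
    exact_mod_cast h3
  -- The first `p_m` basis vectors become the rows of the residuals stacked over all observations.
  -- Lifting them through the residual map gives the data, and a null vector of `S̃_m` would be a
  -- linear relation among them.
  let b := Module.finBasis ℝ
    (((l : {l : Fin M // l ≠ m}) → Fin (p l)) → LinearMap.range (residualMap y u))
  have hli := b.linearIndependent.comp (Fin.castLE hle) (Fin.castLE_injective hle)
  have hex : ∀ a r, ∃ w, residualMap y u w = b (Fin.castLE hle a) r :=
    fun a r => (b (Fin.castLE hle a) r).2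
  choose w hw using hex
  let x : Fin n → Tensor p := fun i J =>
    w (Equiv.piSplitAt m (fun l => Fin (p l)) J).1 (Equiv.piSplitAt m (fun l => Fin (p l)) J).2 i
  refine ⟨x, fun hdet => ?_⟩
  obtain ⟨v, hv0, hv⟩ := Matrix.exists_mulVec_eq_zero_iff.2 hdet
  refine hv0 (funext (Fintype.linearIndependent_iff.1 hli v ?_))
  funext r
  refine Subtype.ext (funext fun i => ?_)
  have hz := congrFun (residual_eq_zero_of_scatter_mulVec hn hv i) r
  have hres : ∀ a, matricize m (residual y u x i) a r =
      (b (Fin.castLE hle a) r : Fin n → ℝ) i := by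
    intro a
    rw [matricize, Matrix.of_apply, residual_apply, ← hw]
    simp only [x, Equiv.apply_symm_apply]
  simp only [Matrix.vecMul, dotProduct, hres, Pi.zero_apply] at hz
  simpa [Finset.sum_apply] using hz

lemma varFirst_nonneg [∀ m, NeZero (p m)] (hn : n ≠ 0) (x : Fin n → Tensor p) :
    0 ≤ varFirst x := by
  have : (1 : ℝ) ≤ n := by exact_mod_cast Nat.one_le_iff_ne_zero.2 hn
  exact mul_nonneg (inv_nonneg.2 (sub_nonneg.2 this)) (Finset.sum_nonneg fun _ _ => sq_nonneg _)

lemma exists_varFirst_ne_zero [∀ m, NeZero (p m)] (hn : 2 ≤ n) :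
    ∃ x : Fin n → Tensor p, varFirst x ≠ 0 := by
  let i₀ : Fin n := ⟨0, by omega⟩
  let i₁ : Fin n := ⟨1, by omega⟩
  refine ⟨fun i _ => if i = i₀ then 1 else 0, fun h => ?_⟩
  have h2 : (2 : ℝ) ≤ n := by exact_mod_cast hn
  rw [varFirst, mul_eq_zero_iff_left (inv_ne_zero (by linarith)),
    Finset.sum_eq_zero_iff_of_nonneg fun _ _ => sq_nonneg _] at h
  have ha := pow_eq_zero_iff two_ne_zero |>.1 (h i₀ (Finset.mem_univ _))
  have hb := pow_eq_zero_iff two_ne_zero |>.1 (h i₁ (Finset.mem_univ _))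
  have hne : i₁ ≠ i₀ := by simp [i₀, i₁]
  rw [if_pos rfl] at ha
  rw [if_neg hne] at hb
  linarith

lemma posDef_sigmaHat [∀ m, NeZero (p m)] {y : Fin n → Fin K}
    {u : Fin n → EuclideanSpace ℝ (Fin q)} {x : Fin n → Tensor p} (hn : n ≠ 0)
    (hdet : ∀ m, (scatter y u x m).det ≠ 0) (hvar : varFirst x ≠ 0) (m : Fin M) :
    (sigmaHat y u x m).PosDef := by
  have hpd : ∀ m, (scatter y u x m).PosDef := fun m =>
    (posSemidef_scatter y u x m).posDef_iff_det_ne_zero.2 (hdet m)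
  have h0 : ∀ m, 0 < scatter y u x m 0 0 := fun m => (hpd m).diag_pos
  rw [sigmaHat]
  split_ifs
  · exact (hpd m).smul (div_pos ((varFirst_nonneg hn x).lt_of_ne' hvar)
      (Finset.prod_pos fun l _ => h0 l))
  · exact (hpd m).smul (inv_pos.2 (h0 m))

end Scatter

/-! ### The estimators as polynomial and as measurable functions -/

section Polynomial

variable {ι κ : Type*} {n K q M : ℕ} {p : Fin M → ℕ}

/-- With `y` and `u` fixed, the inverse Gram matrix enters only through constant coefficients. -/
lemma residual_mem_polyFun (y : Fin n → Fin K) (u : Fin n → EuclideanSpace ℝ (Fin q))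
    {x : (ι → κ → ℝ) → Fin n → Tensor p} (hx : ∀ i j, (fun z => x z i j) ∈ polyFun ι κ)
    (i : Fin n) (j : MIdx p) : (fun z => residual y u (x z) i j) ∈ polyFun ι κ := by
  have h : (fun z => residual y u (x z) i j) = fun z =>
      ∑ i', LinearMap.toMatrix' (residualMap y u) i i' * x z i' j := by
    funext z
    rw [residual_apply, ← LinearMap.toMatrix'_mulVec]
    rfl
  rw [h]
  exact sum_mem_polyFun _ fun i' => const_mul_mem_polyFun _ (hx i' j)

lemma det_scatter_mem_polyFun (y : Fin n → Fin K) (u : Fin n → EuclideanSpace ℝ (Fin q))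
    {x : (ι → κ → ℝ) → Fin n → Tensor p} (hx : ∀ i j, (fun z => x z i j) ∈ polyFun ι κ)
    (m : Fin M) : (fun z => (scatter y u (x z) m).det) ∈ polyFun ι κ := by
  refine det_mem_polyFun fun a b => ?_
  simp only [scatter, Matrix.smul_apply, Matrix.sum_apply, Matrix.mul_apply, smul_eq_mul,
    Matrix.transpose_apply, matricize, Matrix.of_apply]
  exact const_mul_mem_polyFun _ <| sum_mem_polyFun _ fun i => sum_mem_polyFun _ fun r =>
    mul_mem_polyFun (residual_mem_polyFun y u hx i _) (residual_mem_polyFun y u hx i _)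

lemma varFirst_mem_polyFun [∀ m, NeZero (p m)] {x : (ι → κ → ℝ) → Fin n → Tensor p}
    (hx : ∀ i j, (fun z => x z i j) ∈ polyFun ι κ) :
    (fun z => varFirst (x z)) ∈ polyFun ι κ := by
  simp only [varFirst, sq]
  have h : ∀ i, (fun z => x z i (fun _ => 0) - (n : ℝ)⁻¹ * ∑ i', x z i' (fun _ => 0)) ∈
      polyFun ι κ := fun i =>
    sub_mem_polyFun (hx i _) (const_mul_mem_polyFun _ (sum_mem_polyFun _ fun i' => hx i' _))
  exact const_mul_mem_polyFun _ (sum_mem_polyFun _ fun i => mul_mem_polyFun (h i) (h i))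

end Polynomial

section Measurability

variable {α : Type*} [MeasurableSpace α]

lemma measurable_matrix_det {d : ℕ} {A : α → Matrix (Fin d) (Fin d) ℝ}
    (hA : ∀ i j, Measurable fun a => A a i j) : Measurable fun a => (A a).det := by
  simp only [Matrix.det_apply']
  fun_prop

/-- Cramer's rule, valid also at singular matrices, where both sides are zero. -/
lemma measurable_matrix_inv {d : ℕ} {A : α → Matrix (Fin d) (Fin d) ℝ}
    (hA : ∀ i j, Measurable fun a => A a i j) (i j : Fin d) :
    Measurable fun a => (A a)⁻¹ i j := by
  simp only [Matrix.inv_def, Ring.inverse_eq_inv', Matrix.smul_apply, smul_eq_mul,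
    Matrix.adjugate_apply]
  refine (measurable_matrix_det hA).inv.mul (measurable_matrix_det fun k l => ?_)
  simp only [Matrix.updateRow_apply]
  split_ifs
  · exact measurable_const
  · exact hA k l

variable {n K q M : ℕ} {p : Fin M → ℕ} {u : α → Fin n → EuclideanSpace ℝ (Fin q)}
  {x : α → Fin n → Tensor p}

lemma measurable_centered {w : α → Fin n → ℝ} (hw : ∀ i, Measurable fun a => w a i)
    (y : Fin n → Fin K) (i : Fin n) : Measurable fun a => centered y (w a) i := by
  simp only [centered, classMean, smul_eq_mul]
  fun_prop

lemma measurable_det_scatter (hu : ∀ i l, Measurable fun a => u a i l)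
    (hx : ∀ i j, Measurable fun a => x a i j) (y : Fin n → Fin K) (m : Fin M) :
    Measurable fun a => (scatter y (u a) (x a) m).det := by
  have hcu : ∀ l i, Measurable fun a => centeredU y (u a) l i := by
    intro l i
    simp only [centeredU, Matrix.of_apply, centered_euclidean_apply]
    exact measurable_centered (fun i => hu i l) y i
  have hcx : ∀ i j, Measurable fun a => centered y (x a) i j := by
    intro i j
    simp only [centered_tensor_apply]
    exact measurable_centered (fun i => hx i j) y i
  have hgram : ∀ k l, Measurable fun a =>
      (centeredU y (u a) * (centeredU y (u a)).transpose)⁻¹ k l := by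
    refine measurable_matrix_inv fun k l => ?_
    simp only [Matrix.mul_apply, Matrix.transpose_apply]
    fun_prop
  have hres : ∀ i j, Measurable fun a => residual y (u a) (x a) i j := by
    intro i j
    simp only [residual, modeVec, alphaHat, Pi.sub_apply, Matrix.mul_apply]
    exact (hcx i j).sub <| Finset.measurable_fun_sum _ fun l _ => Measurable.mul
      (Finset.measurable_fun_sum _ fun i' _ => Measurable.mul
        (Finset.measurable_fun_sum _ fun l' _ => (hgram l l').mul (hcu l' i')) (hcx i' j))
      (hcu l i)
  refine measurable_matrix_det fun k l => ?_
  simp only [scatter, Matrix.smul_apply, Matrix.sum_apply, Matrix.mul_apply, smul_eq_mul,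
    Matrix.transpose_apply, matricize, Matrix.of_apply]
  fun_prop

lemma measurable_varFirst [∀ m, NeZero (p m)] (hx : ∀ i j, Measurable fun a => x a i j) :
    Measurable fun a => varFirst (x a) := by
  unfold varFirst
  fun_prop

end Measurability

/-! ### The CATCH law -/

section Law

variable {K q M : ℕ} {p : Fin M → ℕ}

lemma tucker_eq_kron_mulVec (z : Tensor p) (G : (m : Fin M) → Matrix (Fin (p m)) (Fin (p m)) ℝ)
    (a : MIdx p) : tucker z G a = (kron G).mulVec (vec z) (finPiFinEquiv a) := by
  simp only [tucker, Matrix.mulVec, dotProduct, kron, vec, Matrix.of_apply, Equiv.symm_apply_apply]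
  exact (finPiFinEquiv.symm.sum_comp fun i : MIdx p => (∏ m, G m (a m) (i m)) * z i).symm

lemma exists_tucker_eq {G : (m : Fin M) → Matrix (Fin (p m)) (Fin (p m)) ℝ}
    (hG : ∀ m, IsUnit (G m)) (T : Tensor p) : ∃ z : Tensor p, tucker z G = T := by
  refine ⟨unvec ((kron G)⁻¹.mulVec (vec T)), ?_⟩
  funext a
  have hvec : ∀ b : Fin (totalDim p) → ℝ, vec (unvec b : Tensor p) = b := fun b => by
    funext j
    simp [vec, unvec]
  rw [tucker_eq_kron_mulVec, hvec, Matrix.mulVec_mulVec, Matrix.mul_nonsing_inv _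
    ((Matrix.isUnit_iff_isUnit_det _).1 (isUnit_kron hG)), Matrix.one_mulVec]
  simp [vec]

/-- One observation of the CATCH model as a function of its label, its covariates and the
standardized tensor error. -/
noncomputable def observation (μ : Fin K → Tensor p) (α : MIdx p → Fin q → ℝ)
    (S : (m : Fin M) → Matrix (Fin (p m)) (Fin (p m)) ℝ)
    (a : (Fin K × EuclideanSpace ℝ (Fin q)) × Tensor p) :
    (Fin K × EuclideanSpace ℝ (Fin q)) × Tensor p :=
  (a.1, μ a.1.1 + modeVec α a.1.2 + tucker a.2 fun m => CFC.sqrt (S m))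

lemma measurable_observation (μ : Fin K → Tensor p) (α : MIdx p → Fin q → ℝ)
    (S : (m : Fin M) → Matrix (Fin (p m)) (Fin (p m)) ℝ) :
    Measurable (observation μ α S) :=
  measurable_fst.prodMk <| (((measurable_of_countable μ).comp
    (measurable_fst.comp measurable_fst)).add ((measurable_modeVec α).comp
    (measurable_snd.comp measurable_fst))).add ((measurable_tucker _).comp measurable_snd)

/-- This separates the standardized errors from labels and covariates, so that the latter can be
frozen by Fubini. -/
lemma catchLaw_eq_map (π : PMF (Fin K)) (φ : Fin K → EuclideanSpace ℝ (Fin q))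
    (Ψ : Matrix (Fin q) (Fin q) ℝ) (μ : Fin K → Tensor p) (α : MIdx p → Fin q → ℝ)
    (S : (m : Fin M) → Matrix (Fin (p m)) (Fin (p m)) ℝ) :
    catchLaw π φ Ψ μ α S =
      ((π.toMeasure.compProd (covariateKernel φ Ψ)).prod
        (Measure.pi fun _ : MIdx p => gaussianReal 0 1)).map (observation μ α S) := by
  ext s hs
  rw [catchLaw, Measure.compProd_apply hs, Measure.map_apply (measurable_observation μ α S) hs,
    Measure.prod_apply (measurable_observation μ α S hs)]
  refine lintegral_congr fun a => ?_
  change tensorNormal (μ a.1 + modeVec α a.2) S (Prod.mk a ⁻¹' s) = _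
  rw [tensorNormal, Measure.map_apply (Measurable.const_add (measurable_tucker _) _)
    (measurable_prodMk_left hs)]
  rfl

/-- There are finitely many label vectors, so measurability can be checked for each one. -/
lemma measurable_of_measurable_of_labels {n : ℕ} {f : (Fin n → Fin K) →
    (Fin n → EuclideanSpace ℝ (Fin q)) → (Fin n → Tensor p) → ℝ}
    (h : ∀ y, Measurable fun d : Fin n → (Fin K × EuclideanSpace ℝ (Fin q)) × Tensor p =>
      f y (fun i => (d i).1.2) (fun i => (d i).2)) :
    Measurable fun d : Fin n → (Fin K × EuclideanSpace ℝ (Fin q)) × Tensor p =>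
      f (fun i => (d i).1.1) (fun i => (d i).1.2) (fun i => (d i).2) := by
  have h' : Measurable fun e : (Fin n → Fin K) ×
      (Fin n → (Fin K × EuclideanSpace ℝ (Fin q)) × Tensor p) =>
      f e.1 (fun i => (e.2 i).1.2) (fun i => (e.2 i).2) :=
    measurable_from_prod_countable_right h
  have hy : Measurable fun d : Fin n → (Fin K × EuclideanSpace ℝ (Fin q)) × Tensor p =>
      fun i => (d i).1.1 :=
    measurable_pi_lambda _ fun i =>
      measurable_fst.comp (measurable_fst.comp (measurable_pi_apply i))
  exact h'.comp (hy.prodMk measurable_id)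

end Law

/-! ### Positive definiteness of the covariance estimates -/

section Almost

variable {n K q M : ℕ} {p : Fin M → ℕ} [∀ m, NeZero (p m)]

/-- A function of the data whose nonvanishing makes all covariance estimates positive definite. -/
noncomputable def nondegeneracy (y : Fin n → Fin K) (u : Fin n → EuclideanSpace ℝ (Fin q))
    (x : Fin n → Tensor p) : ℝ :=
  varFirst x * ∏ m, (scatter y u x m).det

lemma measurable_nondegeneracy_of_labels (y : Fin n → Fin K) :
    Measurable fun d : Fin n → (Fin K × EuclideanSpace ℝ (Fin q)) × Tensor p =>
      nondegeneracy y (fun i => (d i).1.2) (fun i => (d i).2) := by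
  let D := Fin n → (Fin K × EuclideanSpace ℝ (Fin q)) × Tensor p
  have hu : ∀ (i : Fin n) (l : Fin q), Measurable fun d : D => (d i).1.2 l := fun i l =>
    (by fun_prop : Measurable fun v : EuclideanSpace ℝ (Fin q) => v l).comp
      (measurable_snd.comp (measurable_fst.comp (measurable_pi_apply i)))
  have hx : ∀ (i : Fin n) (j : MIdx p), Measurable fun d : D => (d i).2 j := fun i j =>
    (measurable_pi_apply j).comp (measurable_snd.comp (measurable_pi_apply i))
  have h1 := measurable_varFirst (x := fun (d : D) i => (d i).2) hx
  have h2 := fun m => measurable_det_scatter (u := fun (d : D) i => (d i).1.2)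
    (x := fun (d : D) i => (d i).2) hu hx y m
  exact h1.mul (Finset.measurable_fun_prod _ fun m _ => h2 m)

lemma measurable_nondegeneracy :
    Measurable fun d : Fin n → (Fin K × EuclideanSpace ℝ (Fin q)) × Tensor p =>
      nondegeneracy (fun i => (d i).1.1) (fun i => (d i).1.2) (fun i => (d i).2) :=
  measurable_of_measurable_of_labels measurable_nondegeneracy_of_labels

lemma ae_nondegeneracy_ne_zero {π : PMF (Fin K)}
    {φ : Fin K → EuclideanSpace ℝ (Fin q)} {Ψ : Matrix (Fin q) (Fin q) ℝ}
    {μ : Fin K → Tensor p} {α : MIdx p → Fin q → ℝ}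
    {S : (m : Fin M) → Matrix (Fin (p m)) (Fin (p m)) ℝ} (hS : ∀ m, (S m).PosDef) (hn : 2 ≤ n)
    (hdim : ∀ m, (p m : ℤ) ≤ ((n : ℤ) - K - q) * ∏ l ∈ Finset.univ.erase m, (p l : ℤ)) :
    ∀ᵐ d ∂(Measure.pi fun _ : Fin n => catchLaw π φ Ψ μ α S),
      nondegeneracy (fun i => (d i).1.1) (fun i => (d i).1.2) (fun i => (d i).2) ≠ 0 := by
  have hset : MeasurableSet {d : Fin n → (Fin K × EuclideanSpace ℝ (Fin q)) × Tensor p |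
      nondegeneracy (fun i => (d i).1.1) (fun i => (d i).1.2) (fun i => (d i).2) ≠ 0} :=
    measurable_nondegeneracy (measurableSet_singleton 0).compl
  have hobs := measurable_observation μ α S
  have hobs' : Measurable fun (d : Fin n → (Fin K × EuclideanSpace ℝ (Fin q)) × Tensor p) i =>
      observation μ α S (d i) :=
    measurable_pi_lambda _ fun i => hobs.comp (measurable_pi_apply i)
  set ν := π.toMeasure.compProd (covariateKernel φ Ψ)
  set γ := Measure.pi fun _ : MIdx p => gaussianReal 0 1
  have hpi : (Measure.pi fun _ : Fin n => catchLaw π φ Ψ μ α S) =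
      (Measure.pi fun _ : Fin n => ν.prod γ).map fun d i => observation μ α S (d i) := by
    simp only [catchLaw_eq_map]
    exact (Measure.pi_map_pi fun _ => hobs.aemeasurable).symm
  rw [hpi, ae_map_iff hobs'.aemeasurable hset]
  have hmp := measurePreserving_arrowProdEquivProdArrow (Fin K × EuclideanSpace ℝ (Fin q))
    (Tensor p) (Fin n) (fun _ => ν) (fun _ => γ)
  let e := MeasurableEquiv.arrowProdEquivProdArrow (Fin K × EuclideanSpace ℝ (Fin q))
    (Tensor p) (Fin n)
  have key : ∀ᵐ c ∂(Measure.pi fun _ : Fin n => ν).prod (Measure.pi fun _ : Fin n => γ),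
      (fun i => observation μ α S (e.symm c i)) ∈ {d : Fin n → (Fin K ×
        EuclideanSpace ℝ (Fin q)) × Tensor p | nondegeneracy (fun i => (d i).1.1)
          (fun i => (d i).1.2) (fun i => (d i).2) ≠ 0} := by
    -- Fubini: the claim is proved for every fixed value of labels and covariates, with only the
    -- errors random.
    refine (Measure.ae_prod_iff_ae_ae ((hobs'.comp e.symm.measurable) hset)).2 ?_
    refine ae_of_all _ fun c => ?_
    set y : Fin n → Fin K := fun i => (c i).1
    set u : Fin n → EuclideanSpace ℝ (Fin q) := fun i => (c i).2
    let x : (Fin n → Tensor p) → Fin n → Tensor p := fun z i =>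
      μ (y i) + modeVec α (u i) + tucker (z i) fun m => CFC.sqrt (S m)
    have hx : ∀ i j, (fun z => x z i j) ∈ polyFun (Fin n) (MIdx p) := fun i j =>
      add_mem_polyFun (const_mem_polyFun _)
        (sum_mem_polyFun _ fun a => const_mul_mem_polyFun _ (coord_mem_polyFun i a))
    -- The square roots are invertible, so every data set comes from some errors, and witnesses
    -- found among data sets transfer to errors.
    have hsurj : ∀ x₀ : Fin n → Tensor p, ∃ z, x z = x₀ := by
      intro x₀
      choose z hz using fun i => exists_tucker_eq (fun m => isUnit_sqrt_of_posDef (hS m))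
        (x₀ i - (μ (y i) + modeVec α (u i)))
      refine ⟨z, funext fun i => ?_⟩
      simp only [x, hz, add_sub_cancel]
    have hatom : NullSingletonClass (gaussianReal 0 1) :=
      nullSingletonClass_gaussianReal one_ne_zero
    have hvar : ∀ᵐ z ∂(Measure.pi fun _ : Fin n => γ), varFirst (x z) ≠ 0 := by
      obtain ⟨x₀, hx₀⟩ := exists_varFirst_ne_zero (p := p) hn
      obtain ⟨z, rfl⟩ := hsurj x₀
      exact ae_ne_zero_of_mem_polyFun _ (varFirst_mem_polyFun hx) hx₀
    have hdet : ∀ᵐ z ∂(Measure.pi fun _ : Fin n => γ), ∀ m, (scatter y u (x z) m).det ≠ 0 := by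
      refine ae_all_iff.2 fun m => ?_
      obtain ⟨x₀, hx₀⟩ := exists_det_scatter_ne_zero y u m (hdim m)
      obtain ⟨z, rfl⟩ := hsurj x₀
      exact ae_ne_zero_of_mem_polyFun _ (det_scatter_mem_polyFun y u hx m) hx₀
    filter_upwards [hvar, hdet] with z h1 h2
    exact mul_ne_zero h1 (Finset.prod_ne_zero_iff.2 fun m _ => h2 m)
  filter_upwards [hmp.quasiMeasurePreserving.ae key] with d hd
  exact hd

end Almost

end Catch

/-! ### Almost sure convergence of the algorithm -/

theorem theorem1 {Ω : Type*} [MeasurableSpace Ω] (P : Measure Ω) [IsProbabilityMeasure P]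
    (M K q n : ℕ) [NeZero K] (hM : 2 ≤ M) (hK : 2 ≤ K)
    (p : Fin M → ℕ) [∀ m, NeZero (p m)]
    (π : PMF (Fin K)) (hπ : ∀ k, π k ≠ 0)
    (φ : Fin K → EuclideanSpace ℝ (Fin q))
    (Ψ : Matrix (Fin q) (Fin q) ℝ) (hΨ : Ψ.PosDef)
    (μ : Fin K → Catch.Tensor p) (α : Catch.MIdx p → Fin q → ℝ)
    (S : (m : Fin M) → Matrix (Fin (p m)) (Fin (p m)) ℝ) (hS : ∀ m, (S m).PosDef)
    (Y : Fin n → Ω → Fin K) (U : Fin n → Ω → EuclideanSpace ℝ (Fin q))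
    (X : Fin n → Ω → Catch.Tensor p)
    (hlaw : ∀ i, HasLaw (fun ω => ((Y i ω, U i ω), X i ω)) (Catch.catchLaw π φ Ψ μ α S) P)
    (hindep : iIndepFun (fun i ω => ((Y i ω, U i ω), X i ω)) P)
    (hdim : ∀ m, (p m : ℤ) ≤ ((n : ℤ) - K - q) * ∏ l ∈ Finset.univ.erase m, (p l : ℤ)) :
    ∀ᵐ ω ∂P, ∀ lam : ℝ, 0 < lam →
      let y : Fin n → Fin K := fun i => Y i ω
      let u : Fin n → EuclideanSpace ℝ (Fin q) := fun i => U i ω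
      let x : Fin n → Catch.Tensor p := fun i => X i ω
      ∃ β : Catch.Coef K p,
        (∀ β' : Catch.Coef K p, β' ≠ β →
          Catch.objective (Catch.sigmaHat y u x) (Catch.muHat y u x) lam β <
            Catch.objective (Catch.sigmaHat y u x) (Catch.muHat y u x) lam β') ∧
        Tendsto (fun w => Catch.iterate (Catch.sigmaHat y u x) (Catch.muHat y u x) lam w)
          atTop (𝓝 β) := by
  -- The dimension condition forces `n > K + q ≥ 2`; two observations are needed for a nonzero
  -- sample variance.
  have hn : 2 ≤ n := by
    let m : Fin M := ⟨0, by omega⟩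
    have hpm : 0 < (p m : ℤ) := by exact_mod_cast Nat.pos_of_ne_zero (NeZero.ne (p m))
    have hprod : 0 ≤ ∏ l ∈ Finset.univ.erase m, (p l : ℤ) :=
      Finset.prod_nonneg fun l _ => Int.natCast_nonneg _
    have := pos_of_mul_pos_left (hpm.trans_le (hdim m)) hprod
    omega
  have hae : ∀ i, AEMeasurable (fun ω => ((Y i ω, U i ω), X i ω)) P :=
    fun i => (hlaw i).aemeasurable
  have hmap : P.map (fun ω i => ((Y i ω, U i ω), X i ω)) =
      Measure.pi fun _ : Fin n => Catch.catchLaw π φ Ψ μ α S := by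
    rw [(iIndepFun_iff_map_fun_eq_pi_map hae).1 hindep]
    congr 1
    funext i
    exact (hlaw i).map_eq
  have hgood := Catch.ae_nondegeneracy_ne_zero (π := π) (φ := φ) (Ψ := Ψ) (μ := μ) (α := α)
    hS hn hdim
  rw [← hmap] at hgood
  filter_upwards [ae_of_ae_map (aemeasurable_pi_lambda _ hae) hgood] with ω hω
  intro lam hlam
  refine Catch.exists_unique_minimizer_and_tendsto_iterate (fun m => ?_) _ hlam
  exact Catch.posDef_sigmaHat (by omega)
    (fun m => Finset.prod_ne_zero_iff.1 (right_ne_zero_of_mul hω) m (Finset.mem_univ m))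
    (left_ne_zero_of_mul hω) m
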